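/- Let $\mathbb K$ be any field. For a finite set $A=\{a_1,\dots,a_n\}$ of positive integers let $I_A\subseteq\mathbb K[x_1,\dots,x_n]$ be its toric ideal, generated by all $\mathbf x^{\mathbf u}-\mathbf x^{\mathbf v}$ with $\sum_i u_ia_i=\sum_i v_ia_i$. A binomial is a polynomial $\mathbf x^{\mathbf u}-\mathbf x^{\mathbf v}$ with $\mathbf u\neq\mathbf v$ in $\mathbb N^n$; its support is $\operatorname{supp}(\mathbf u)\cup\operatorname{supp}(\mathbf v)$. Binomials of opposite sign are identified in all of the following sets, and the size of such a set is its number of elements after this identification. - The Graver basis $\operatorname{Gr}_A$ is the set of binomials $\mathbf x^{\mathbf u}-\mathbf x^{\mathbf v}\in I_A$ for which there is no other binomial $\mathbf x^{\mathbf w}-\mathbf x^{\mathbf z}\in I_A$ with $\mathbf x^{\mathbf w}\mid\mathbf x^{\mathbf u}$ and $\mathbf x^{\mathbf z}\mid\mathbf x^{\mathbf v}$. - The universal Markov basis $\mathcal M_A$ is the union of all inclusion-minimal sets of binomials generating $I_A$. - The universal Gröbner basis $\mathcal U_A$ is the union of the reduced Gröbner bases of $I_A$ for all monomial orders. - The set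 of circuits $\mathcal C_A$ is the set of binomials $\mathbf x^{\mathbf u}-\mathbf x^{\mathbf v}\in I_A$ such that $\operatorname{supp}(\mathbf u)\cap\operatorname{supp}(\mathbf v)=\emptyset$, the nonzero entries of $\mathbf u+\mathbf v$ are relatively prime, and no binomial of $I_A$ has a strictly smaller support (with respect to inclusion). Then for every $N\in\mathbb N$ there is a numerical semigroup with minimal generating set $A=\{a_1,a_2,a_3\}$ of three elements such that $\mathcal U_A=\mathcal C_A$ has exactly $3$ elements, while $\operatorname{Gr}_A=\mathcal M_A$ is finite and has at least $N$ elements. In particular, neither the size of $\operatorname{Gr}_A$ nor the size of $\mathcal M_A$ can be bounded above by a function of the size of $\mathcal U_A$, nor by a function of the size of $\mathcal C_A$: for each of the four pairs $(X,Y)\in\{\operatorname{Gr},\mathcal M\}\times\{\mathcal U,\mathcal C\}$ there is no function $F:\mathbb N\to\mathbb N$ such that $|X_A|\le F(|Y_A|)$ for all finite sets $A$ of positive integers. -/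

import Mathlib

open MvPolynomial

namespace ToricBases

/-- The `A`-degree `∑ uᵢ aᵢ` of the monomial `x ^ u`, where `A = {a₁, …, aₙ}`. -/
def aDegree {n : ℕ} (a : Fin n → ℕ) (u : Fin n →₀ ℕ) : ℕ :=
  ∑ i, u i * a i

/-- The pure difference `x ^ u - x ^ v` in `K[x₁, …, xₙ]`. -/
noncomputable def binom (K : Type*) [Field K] {n : ℕ} (u v : Fin n →₀ ℕ) :
    MvPolynomial (Fin n) K :=
  monomial u 1 - monomial v 1

/-- The toric ideal `I_A`, generated by all `A`-homogeneous pure differences. -/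
noncomputable def toricIdeal (K : Type*) [Field K] {n : ℕ} (a : Fin n → ℕ) :
    Ideal (MvPolynomial (Fin n) K) :=
  Ideal.span {f | ∃ u v : Fin n →₀ ℕ, aDegree a u = aDegree a v ∧ f = binom K u v}

/-- `a₁, …, aₙ` is the minimal generating set of a numerical semigroup: the `aᵢ` are relatively
prime and none of them lies in the monoid generated by the others (in particular the `aᵢ` are
positive and pairwise distinct). -/
def IsMinimalNumericalGenerators {n : ℕ} (a : Fin n → ℕ) : Prop :=
  Finset.univ.gcd a = 1 ∧ ∀ i, a i ∉ AddSubmonoid.closure (a '' {j | j ≠ i})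

/-- `x ^ u - x ^ v` is a (nonzero) binomial of `I_A`. -/
def IsBinomialOf (K : Type*) [Field K] {n : ℕ} (a : Fin n → ℕ) (u v : Fin n →₀ ℕ) : Prop :=
  u ≠ v ∧ binom K u v ∈ toricIdeal K a

/-- The Graver basis `Gr_A`: the primitive binomials of `I_A` (with both signs). Divisibility of
monomials is the componentwise order of the exponents. -/
def graverBasis (K : Type*) [Field K] {n : ℕ} (a : Fin n → ℕ) : Set (MvPolynomial (Fin n) K) :=
  {f | ∃ u v : Fin n →₀ ℕ, f = binom K u v ∧ IsBinomialOf K a u v ∧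
    ∀ w z : Fin n →₀ ℕ, IsBinomialOf K a w z → w ≤ u → z ≤ v → w = u ∧ z = v}

/-- `x ^ u - x ^ v` is irreducible: the supports of `u` and `v` are disjoint, and the nonzero
entries of `u + v` are relatively prime (zero entries do not change a gcd). -/
def IsIrreducibleExponents {n : ℕ} (u v : Fin n →₀ ℕ) : Prop :=
  Disjoint u.support v.support ∧ Finset.univ.gcd (fun i => u i + v i) = 1

/-- The set of circuits `C_A` (with both signs): the irreducible binomials of `I_A` whose support
is minimal among the supports of all binomials of `I_A`. -/
def circuits (K : Type*) [Field K] {n : ℕ} (a : Fin n → ℕ) : Set (MvPolynomial (Fin n) K) :=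
  {f | ∃ u v : Fin n →₀ ℕ, f = binom K u v ∧ IsBinomialOf K a u v ∧ IsIrreducibleExponents u v ∧
    ¬ ∃ u' v' : Fin n →₀ ℕ, IsBinomialOf K a u' v' ∧
      u'.support ∪ v'.support ⊂ u.support ∪ v.support}

/-- `B` is a set of nonzero pure difference binomials generating `I_A`. -/
def IsBinomialGeneratingSet (K : Type*) [Field K] {n : ℕ} (a : Fin n → ℕ)
    (B : Set (MvPolynomial (Fin n) K)) : Prop :=
  (∀ f ∈ B, ∃ u v : Fin n →₀ ℕ, u ≠ v ∧ f = binom K u v) ∧ Ideal.span B = toricIdeal K a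

/-- A Markov basis of `I_A`: a binomial generating set which is minimal for inclusion. -/
def IsMarkovBasis (K : Type*) [Field K] {n : ℕ} (a : Fin n → ℕ)
    (B : Set (MvPolynomial (Fin n) K)) : Prop :=
  IsBinomialGeneratingSet K a B ∧ ∀ B' ⊂ B, ¬ IsBinomialGeneratingSet K a B'

/-- The universal Markov basis `M_A` (with both signs): the union of all Markov bases. -/
def universalMarkovBasis (K : Type*) [Field K] {n : ℕ} (a : Fin n → ℕ) :
    Set (MvPolynomial (Fin n) K) :=
  {f | ∃ B, IsMarkovBasis K a B ∧ f ∈ B}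

/-- The initial ideal of `I` for the monomial order `m`. -/
noncomputable def initialIdeal {K : Type*} [Field K] {n : ℕ} (m : MonomialOrder (Fin n))
    (I : Ideal (MvPolynomial (Fin n) K)) : Ideal (MvPolynomial (Fin n) K) :=
  Ideal.span {p | ∃ f ∈ I, f ≠ 0 ∧ p = monomial (m.degree f) 1}

/-- `G` is a Gröbner basis of `I` for `m`: a finite set of nonzero elements of `I` whose initial
monomials generate the initial ideal. -/
def IsGroebnerBasis {K : Type*} [Field K] {n : ℕ} (m : MonomialOrder (Fin n))
    (I : Ideal (MvPolynomial (Fin n) K)) (G : Set (MvPolynomial (Fin n) K)) : Prop :=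
  G.Finite ∧ (∀ g ∈ G, g ∈ I ∧ g ≠ 0) ∧
    Ideal.span ((fun g => (monomial (m.degree g) 1 : MvPolynomial (Fin n) K)) '' G) =
      initialIdeal m I

/-- `G` is the reduced Gröbner basis of `I` for `m`: its elements have leading coefficient one, and
no monomial of an element is divisible by the initial monomial of another element. -/
def IsReducedGroebnerBasis {K : Type*} [Field K] {n : ℕ} (m : MonomialOrder (Fin n))
    (I : Ideal (MvPolynomial (Fin n) K)) (G : Set (MvPolynomial (Fin n) K)) : Prop :=
  IsGroebnerBasis m I G ∧ (∀ g ∈ G, m.leadingCoeff g = 1) ∧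
    ∀ g ∈ G, ∀ h ∈ G, h ≠ g → ∀ u ∈ g.support, ¬ m.degree h ≤ u

/-- The universal Gröbner basis `U_A`: the union of all reduced Gröbner bases of `I_A`. The
universe level is no restriction: every monomial order on `Fin n →₀ ℕ` can be realised on a type
in the lowest universe. -/
def universalGroebnerBasis (K : Type*) [Field K] {n : ℕ} (a : Fin n → ℕ) :
    Set (MvPolynomial (Fin n) K) :=
  {f | ∃ (m : MonomialOrder.{0, 0} (Fin n)) (G : Set (MvPolynomial (Fin n) K)),
    IsReducedGroebnerBasis m (toricIdeal K a) G ∧ f ∈ G}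

/-- The set `S` with polynomials of opposite sign identified: the set of all classes `{f, -f}`
with `f ∈ S`. -/
def upToSign {R : Type*} [Ring R] (S : Set R) : Set (Set R) :=
  (fun f => {f, -f}) '' S

/-- The size of a set of polynomials in which opposite signs are identified. -/
noncomputable def size {R : Type*} [Ring R] (S : Set R) : ℕ :=
  (upToSign S).ncard

end ToricBases

/-! Take the generators 15, 10, 6T with 5 ∤ T and T ≥ 2. Put X = x², Y = y³, Z = z⁵, of degrees 30,
30, 30T. Exponent differences of binomials in `I_A` are exactly the vectors (2p, 3q, 5r) with p + q
+ Tr = 0 (`exists_lattice_coordinates`), so `I_A` is governed by X - Y and by the T + 1 relations Z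
- XⁱYʲ with i + j = T.

All these T + 2 binomials are primitive, and there are no others. Modulo X - Y the monomials XⁱYʲ of
degree i + j = T agree, so X - Y and any single Z - XⁱYʲ generate `I_A` minimally
(`toricIdeal_le_of_mem`, `isMarkovBasis_pair`); thus Graver and universal Markov bases coincide up
to sign.

A monomial order, however, reduces XⁱYʲ to Yᵀ if Y < X and to Xᵀ if X < Y. Reduced Gröbner bases
therefore contain, up to sign, only X - Y, Z - Yᵀ and Z - Xᵀ, which are also the circuits. Letting T
grow keeps the latter size at 3 and makes the former unbounded. -/

namespace ToricBases

/-! ### Binomials in toric ideals -/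

section Binomials

variable {K : Type*} [Field K] {n : ℕ} {a : Fin n → ℕ}

lemma aDegree_add (a : Fin n → ℕ) (u v : Fin n →₀ ℕ) :
    aDegree a (u + v) = aDegree a u + aDegree a v := by
  simp [aDegree, add_mul, Finset.sum_add_distrib]

lemma neg_binom (u v : Fin n →₀ ℕ) : -binom K u v = binom K v u := by
  simp [binom]

lemma support_binom {u v : Fin n →₀ ℕ} (h : u ≠ v) : (binom K u v).support = {u, v} := by
  classical
  ext w
  simp only [binom, mem_support_iff, coeff_sub, coeff_monomial, Finset.mem_insert,
    Finset.mem_singleton]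
  by_cases h1 : u = w
  · subst h1
    simp [Ne.symm h]
  · by_cases h2 : v = w
    · subst h2
      simp [h]
    · simp [h1, h2, Ne.symm h1, Ne.symm h2]

lemma binom_ne_zero {u v : Fin n →₀ ℕ} (h : u ≠ v) : binom K u v ≠ 0 := by
  intro h0
  have := support_binom (K := K) h
  rw [h0] at this
  have h' : u ∈ (∅ : Finset (Fin n →₀ ℕ)) := by
    rw [← support_zero (R := K), this]
    simp
  simp at h'

lemma coeff_binom_left {u v : Fin n →₀ ℕ} (h : u ≠ v) : coeff u (binom K u v) = 1 := by
  simp [binom, coeff_monomial, h.symm]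

lemma binom_add_binom (u v w : Fin n →₀ ℕ) : binom K u v + binom K v w = binom K u w := by
  simp [binom]

lemma monomial_mul_binom (c u v : Fin n →₀ ℕ) :
    monomial c 1 * binom K u v = binom K (c + u) (c + v) := by
  simp [binom, mul_sub, monomial_mul]

/-- The monomial curve `xᵢ ↦ t ^ aᵢ`. -/
noncomputable def monomialCurve (K : Type*) [Field K] (a : Fin n → ℕ) :
    MvPolynomial (Fin n) K →ₐ[K] Polynomial K :=
  aeval fun i => Polynomial.X ^ a i

lemma monomialCurve_monomial (u : Fin n →₀ ℕ) (r : K) :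
    monomialCurve K a (monomial u r) = Polynomial.monomial (aDegree a u) r := by
  rw [monomialCurve, aeval_monomial, Finsupp.prod_fintype _ _ (by simp),
    ← Polynomial.C_mul_X_pow_eq_monomial]
  simp only [← pow_mul, Finset.prod_pow_eq_pow_sum, aDegree, mul_comm (a _)]
  rfl

lemma monomialCurve_eq_zero {f : MvPolynomial (Fin n) K} (hf : f ∈ toricIdeal K a) :
    monomialCurve K a f = 0 := by
  have : toricIdeal K a ≤ RingHom.ker (monomialCurve K a) := by
    refine Ideal.span_le.2 ?_
    rintro _ ⟨u, v, h, rfl⟩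
    simp [binom, RingHom.mem_ker, monomialCurve_monomial, h]
  exact this hf

/-- The monomial curve kills `I_A` and sends the binomial to a difference of powers of t, which
vanishes only if the two degrees agree. -/
lemma binom_mem_toricIdeal_iff {u v : Fin n →₀ ℕ} :
    binom K u v ∈ toricIdeal K a ↔ aDegree a u = aDegree a v := by
  refine ⟨fun h => ?_, fun h => Ideal.subset_span ⟨u, v, h, rfl⟩⟩
  have h0 := monomialCurve_eq_zero h
  rw [binom, map_sub, monomialCurve_monomial, monomialCurve_monomial, sub_eq_zero] at h0
  by_contra hne
  have h1 := congrArg (fun p => Polynomial.coeff p (aDegree a u)) h0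
  simp [Polynomial.coeff_monomial, Ne.symm hne] at h1

lemma isBinomialOf_iff {u v : Fin n →₀ ℕ} :
    IsBinomialOf K a u v ↔ u ≠ v ∧ aDegree a u = aDegree a v := by
  rw [IsBinomialOf, binom_mem_toricIdeal_iff]

/-- No `A`-graded component of an element of `I_A` is a single term. -/
lemma exists_ne_of_mem_support {f : MvPolynomial (Fin n) K} (hf : f ∈ toricIdeal K a)
    {w : Fin n →₀ ℕ} (hw : w ∈ f.support) :
    ∃ w' ∈ f.support, w' ≠ w ∧ aDegree a w' = aDegree a w := by
  by_contra! hcon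
  have h0 := monomialCurve_eq_zero hf
  rw [f.as_sum, map_sum] at h0
  have h1 := congrArg (fun p => Polynomial.coeff p (aDegree a w)) h0
  simp only [monomialCurve_monomial, Polynomial.finsetSum_coeff, Polynomial.coeff_monomial,
    Polynomial.coeff_zero] at h1
  -- If w is alone in its degree, nothing can cancel its coefficient in the image of f.
  rw [Finset.sum_eq_single_of_mem w hw fun b hb hbw => if_neg (hcon b hb hbw)] at h1
  simp only [if_true] at h1
  exact mem_support_iff.1 hw h1

/-- The polynomials none of whose monomials divide xᵐ form an ideal. If it contained B it would
contain f. This later forces x² and z⁵ to occur in every binomial generating set. -/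
lemma exists_le_of_mem_span_binomials {B : Set (MvPolynomial (Fin n) K)}
    (hB : ∀ f ∈ B, ∃ u v : Fin n →₀ ℕ, u ≠ v ∧ f = binom K u v)
    {f : MvPolynomial (Fin n) K} (hf : f ∈ Ideal.span B) {m : Fin n →₀ ℕ} (hm : coeff m f ≠ 0) :
    ∃ u v : Fin n →₀ ℕ, u ≠ v ∧ u ≤ m ∧ (binom K u v ∈ B ∨ binom K v u ∈ B) := by
  by_contra! hcon
  have hs : IsUpperSet {w : Fin n →₀ ℕ | ¬ w ≤ m} := fun x y hxy hx hy => hx (hxy.trans hy)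
  have hle : Ideal.span B ≤ restrictSupportIdeal K _ hs := by
    refine Ideal.span_le.2 fun g hg => ?_
    obtain ⟨u, v, huv, rfl⟩ := hB g hg
    change _ ∈ restrictSupport K _
    rw [mem_restrictSupport_iff, support_binom huv]
    intro w hw
    simp only [Finset.coe_insert, Finset.coe_singleton, Set.mem_insert_iff,
      Set.mem_singleton_iff] at hw
    rcases hw with rfl | rfl
    · exact fun h => (hcon _ v huv h).1 hg
    · exact fun h => (hcon _ u huv.symm h).2 hg
  have hmem : f ∈ restrictSupport K _ := hle hf
  rw [mem_restrictSupport_iff] at hmem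
  exact hmem (Finset.mem_coe.2 (mem_support_iff.2 hm)) le_rfl

end Binomials

/-! ### Gröbner bases and uniqueness of the reduced one -/

section Groebner

variable {K : Type*} [Field K] {n : ℕ} {m : MonomialOrder (Fin n)}
  {I : Ideal (MvPolynomial (Fin n) K)} {G H : Set (MvPolynomial (Fin n) K)}

lemma IsGroebnerBasis.exists_degree_le (hG : IsGroebnerBasis m I G)
    {f : MvPolynomial (Fin n) K} (hf : f ∈ I) (h0 : f ≠ 0) :
    ∃ g ∈ G, m.degree g ≤ m.degree f := by
  classical
  have h1 : (monomial (m.degree f) 1 : MvPolynomial (Fin n) K) ∈ initialIdeal m I :=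
    Ideal.subset_span ⟨f, hf, h0, rfl⟩
  rw [← hG.2.2, ← Function.comp_def (fun d => (monomial d 1 : MvPolynomial (Fin n) K)) m.degree,
    Set.image_comp, mem_ideal_span_monomial_image] at h1
  obtain ⟨_, ⟨g, hg, rfl⟩, hle⟩ := h1 (m.degree f) (by simp [mem_support_iff])
  exact ⟨g, hg, hle⟩

lemma isGroebnerBasis_of_exists_degree_le (hfin : G.Finite) (hG : ∀ g ∈ G, g ∈ I ∧ g ≠ 0)
    (h : ∀ f ∈ I, f ≠ 0 → ∃ g ∈ G, m.degree g ≤ m.degree f) : IsGroebnerBasis m I G := by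
  refine ⟨hfin, hG, le_antisymm (Ideal.span_mono ?_) (Ideal.span_le.2 ?_)⟩
  · rintro _ ⟨g, hg, rfl⟩
    exact ⟨g, (hG g hg).1, (hG g hg).2, rfl⟩
  · rintro _ ⟨f, hf, h0, rfl⟩
    obtain ⟨g, hg, hle⟩ := h f hf h0
    have hdvd : (monomial (m.degree g) 1 : MvPolynomial (Fin n) K) ∣ monomial (m.degree f) 1 := by
      simp [monomial_dvd_monomial, hle]
    exact Ideal.mem_of_dvd _ hdvd (Ideal.subset_span ⟨g, hg, rfl⟩)

lemma IsReducedGroebnerBasis.eq_degree_of_mem_support (hG : IsReducedGroebnerBasis m I G)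
    {g : MvPolynomial (Fin n) K} (hg : g ∈ G) {f : MvPolynomial (Fin n) K} (hf : f ∈ I)
    (h0 : f ≠ 0) (hfg : m.degree f ∈ g.support) : m.degree f = m.degree g := by
  obtain ⟨g', hg', hle⟩ := hG.1.exists_degree_le hf h0
  by_cases h : g' = g
  · subst h
    exact m.toSyn.injective (le_antisymm (m.le_degree hfg) (m.toSyn_monotone hle))
  · exact absurd hle (hG.2.2 g hg g' hg' h _ hfg)

/-- The reduced Gröbner basis of an ideal is unique. -/
lemma IsReducedGroebnerBasis.subset (hG : IsReducedGroebnerBasis m I G)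
    (hH : IsReducedGroebnerBasis m I H) : G ⊆ H := by
  intro g hg
  obtain ⟨hgI, hg0⟩ := hG.1.2.1 g hg
  obtain ⟨h, hh, hhg⟩ := hH.1.exists_degree_le hgI hg0
  obtain ⟨hhI, hh0⟩ := hH.1.2.1 h hh
  obtain ⟨g', hg', hgh⟩ := hG.1.exists_degree_le hhI hh0
  have hgg : g' = g := by
    by_contra hne
    exact hG.2.2 g hg g' hg' hne _ (m.degree_mem_support hg0) (hgh.trans hhg)
  subst hgg
  have hdeg : m.degree h = m.degree g' := le_antisymm hhg hgh
  -- The leading monomial of g' - h occurs in g' or in h, so by reducedness it is their common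
  -- leading monomial; but there the coefficients 1 - 1 cancel.
  by_contra hgH
  have hne : g' - h ≠ 0 := fun h0 => hgH (sub_eq_zero.1 h0 ▸ hh)
  have hI : g' - h ∈ I := I.sub_mem hgI hhI
  have hd := m.degree_mem_support hne
  have hcoeff : coeff (m.degree g') (g' - h) = 0 := by
    have h1 := hG.2.1 g' hg
    have h2 := hH.2.1 h hh
    rw [MonomialOrder.leadingCoeff] at h1 h2
    rw [hdeg] at h2
    rw [coeff_sub, h1, h2, sub_self]
  have hd' : m.degree (g' - h) = m.degree g' := by
    rcases Finset.mem_union.1 (support_sub (Fin n) g' h hd) with hs | hs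
    · exact hG.eq_degree_of_mem_support hg hI hne hs
    · exact (hH.eq_degree_of_mem_support hh hI hne hs).trans hdeg
  rw [hd'] at hd
  exact mem_support_iff.1 hd hcoeff

lemma degree_binom {u v : Fin n →₀ ℕ} (h : m.toSyn v < m.toSyn u) :
    m.degree (binom K u v) = u := by
  have hne : u ≠ v := fun h' => by simp [h'] at h
  have hu : u ∈ (binom K u v).support := by simp [support_binom hne]
  have h0 := m.degree_mem_support (binom_ne_zero (K := K) hne)
  rw [support_binom hne, Finset.mem_insert, Finset.mem_singleton] at h0
  refine h0.resolve_right fun h1 => ?_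
  have := m.le_degree hu
  rw [h1] at this
  exact absurd h this.not_gt

/-! ### Toric ideals with a two-element Gröbner basis -/

section Pair

variable {a : Fin n → ℕ} {p p' q q' : Fin n →₀ ℕ}

/-- Rewriting by `x ^ p → x ^ p'` and `x ^ q → x ^ q'` leads to a monomial that is divisible by
neither `x ^ p` nor `x ^ q`. -/
lemma exists_standard (hp : m.toSyn p' < m.toSyn p) (hq : m.toSyn q' < m.toSyn q)
    (hpa : aDegree a p = aDegree a p') (hqa : aDegree a q = aDegree a q') (w : Fin n →₀ ℕ) :
    ∃ s, aDegree a w = aDegree a s ∧ m.toSyn s ≤ m.toSyn w ∧ ¬ p ≤ s ∧ ¬ q ≤ s ∧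
      binom K w s ∈ Ideal.span {binom K p p', binom K q q'} := by
  induction hw : m.toSyn w using WellFoundedLT.induction generalizing w with
  | _ x ih =>
    subst hw
    have step : ∀ r r' : Fin n →₀ ℕ, m.toSyn r' < m.toSyn r → aDegree a r = aDegree a r' →
        binom K r r' ∈ Ideal.span {binom K p p', binom K q q'} → r ≤ w →
        ∃ s, aDegree a w = aDegree a s ∧ m.toSyn s ≤ m.toSyn w ∧ ¬ p ≤ s ∧ ¬ q ≤ s ∧
          binom K w s ∈ Ideal.span {binom K p p', binom K q q'} := by
      intro r r' hr hra hmem hle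
      obtain ⟨c, rfl⟩ := exists_add_of_le hle
      have hlt : m.toSyn (c + r') < m.toSyn (r + c) := by
        rw [add_comm r, map_add, map_add]
        exact add_lt_add_right hr _
      obtain ⟨s, h1, h2, h3, h4, h5⟩ := ih _ hlt _ rfl
      refine ⟨s, ?_, h2.trans hlt.le, h3, h4, ?_⟩
      · rw [← h1, aDegree_add, aDegree_add, hra, add_comm]
      · rw [← binom_add_binom (r + c) (c + r') s, add_comm r c, ← monomial_mul_binom c r r']
        exact Ideal.add_mem _ (Ideal.mul_mem_left _ _ hmem) h5
    by_cases h1 : p ≤ w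
    · exact step p p' hp hpa (Ideal.subset_span (by simp)) h1
    · by_cases h2 : q ≤ w
      · exact step q q' hq hqa (Ideal.subset_span (by simp)) h2
      · exact ⟨w, rfl, le_rfl, h1, h2, by simp [binom]⟩

variable (hp : m.toSyn p' < m.toSyn p) (hq : m.toSyn q' < m.toSyn q)
  (hpa : aDegree a p = aDegree a p') (hqa : aDegree a q = aDegree a q')
  (huniq : ∀ w w', aDegree a w = aDegree a w' → ¬ p ≤ w → ¬ q ≤ w → ¬ p ≤ w' → ¬ q ≤ w' →
    w = w')

include hp hq hpa hqa huniq

/-- Two monomials of equal degree rewrite to standard monomials of that same degree, and `huniq`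
allows only one of these. -/
lemma toricIdeal_eq_span_pair :
    toricIdeal K a = Ideal.span {binom K p p', binom K q q'} := by
  refine le_antisymm (Ideal.span_le.2 ?_) (Ideal.span_le.2 ?_)
  · rintro _ ⟨u, v, h, rfl⟩
    obtain ⟨s, hs1, -, hs2, hs3, hs4⟩ := exists_standard (K := K) hp hq hpa hqa u
    obtain ⟨t, ht1, -, ht2, ht3, ht4⟩ := exists_standard (K := K) hp hq hpa hqa v
    obtain rfl := huniq s t (by rw [← hs1, ← ht1, h]) hs2 hs3 ht2 ht3
    rw [← binom_add_binom u s v, ← neg_binom v s]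
    exact Ideal.add_mem _ hs4 (Ideal.neg_mem_iff _ |>.2 ht4)
  · rintro f (rfl | rfl)
    · exact binom_mem_toricIdeal_iff.2 hpa
    · exact binom_mem_toricIdeal_iff.2 hqa

/-- Uniqueness of standard monomials in each degree replaces Buchberger's criterion. -/
lemma isReducedGroebnerBasis_pair (hpq : ¬ p ≤ q) (hpq' : ¬ p ≤ q') (hqp : ¬ q ≤ p)
    (hqp' : ¬ q ≤ p') :
    IsReducedGroebnerBasis m (toricIdeal K a) {binom K p p', binom K q q'} := by
  have hp0 : p ≠ p' := fun h => by simp [h] at hp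
  have hq0 : q ≠ q' := fun h => by simp [h] at hq
  refine ⟨isGroebnerBasis_of_exists_degree_le (Set.toFinite _) ?_ ?_, ?_, ?_⟩
  · rintro f (rfl | rfl)
    · exact ⟨binom_mem_toricIdeal_iff.2 hpa, binom_ne_zero hp0⟩
    · exact ⟨binom_mem_toricIdeal_iff.2 hqa, binom_ne_zero hq0⟩
  · intro f hf h0
    by_contra! hcon
    have h1 := hcon (binom K p p') (by simp)
    have h2 := hcon (binom K q q') (by simp)
    rw [degree_binom hp] at h1
    rw [degree_binom hq] at h2
    -- A standard leading monomial would be the normal form of another monomial w of f of the same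
    -- degree, hence at most w in the order, although w is not leading.
    obtain ⟨w, hw, hne, hdeg⟩ := exists_ne_of_mem_support hf (m.degree_mem_support h0)
    obtain ⟨s, hs1, hs, hs2, hs3, -⟩ := exists_standard (K := K) hp hq hpa hqa w
    obtain rfl := huniq _ s (by rw [← hs1, hdeg]) h1 h2 hs2 hs3
    exact hne (m.toSyn.injective (le_antisymm (m.le_degree hw) hs))
  · rintro f (rfl | rfl)
    · rw [MonomialOrder.leadingCoeff, degree_binom hp, coeff_binom_left hp0]
    · rw [MonomialOrder.leadingCoeff, degree_binom hq, coeff_binom_left hq0]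
  · rintro f (rfl | rfl) g (rfl | rfl) hne u hu
    · exact absurd rfl hne
    · rw [degree_binom hq]
      rw [support_binom hp0, Finset.mem_insert, Finset.mem_singleton] at hu
      rcases hu with rfl | rfl <;> assumption
    · rw [degree_binom hp]
      rw [support_binom hq0, Finset.mem_insert, Finset.mem_singleton] at hu
      rcases hu with rfl | rfl <;> assumption
    · exact absurd rfl hne

end Pair

end Groebner

/-! ### Identification of opposite signs -/

section Signs

variable {R : Type*} [Ring R]

lemma upToSign_subset {S S' : Set R} (h : ∀ f ∈ S, f ∈ S' ∨ -f ∈ S') :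
    upToSign S ⊆ upToSign S' := by
  rintro _ ⟨f, hf, rfl⟩
  rcases h f hf with h | h
  · exact ⟨f, h, rfl⟩
  · exact ⟨-f, h, by simp [Set.pair_comm]⟩

lemma upToSign_eq {S S' : Set R} (h : ∀ f ∈ S, f ∈ S' ∨ -f ∈ S')
    (h' : ∀ f ∈ S', f ∈ S ∨ -f ∈ S) : upToSign S = upToSign S' :=
  (upToSign_subset h).antisymm (upToSign_subset h')

end Signs

end ToricBases

namespace ToricBases

/-! ### The lattice of the generators 15, 10, 6T -/

section Exponents

/-- The exponent vector `(p, q, r)`. -/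
noncomputable def tri (p q r : ℕ) : Fin 3 →₀ ℕ := Finsupp.equivFunOnFinite.symm ![p, q, r]

@[simp] lemma tri_zero (p q r : ℕ) : tri p q r 0 = p := rfl
@[simp] lemma tri_one (p q r : ℕ) : tri p q r 1 = q := rfl
@[simp] lemma tri_two (p q r : ℕ) : tri p q r 2 = r := rfl

lemma exponents_ext {u v : Fin 3 →₀ ℕ} (h0 : u 0 = v 0) (h1 : u 1 = v 1) (h2 : u 2 = v 2) :
    u = v := by
  ext i
  fin_cases i <;> assumption

lemma exponents_le_iff {u v : Fin 3 →₀ ℕ} : u ≤ v ↔ u 0 ≤ v 0 ∧ u 1 ≤ v 1 ∧ u 2 ≤ v 2 := by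
  refine ⟨fun h => ⟨h 0, h 1, h 2⟩, fun h i => ?_⟩
  fin_cases i
  exacts [h.1, h.2.1, h.2.2]

/-- The generators `15, 10, 6 T`. -/
def weights (T : ℕ) : Fin 3 → ℕ := ![15, 10, 6 * T]

lemma aDegree_weights (T : ℕ) (u : Fin 3 →₀ ℕ) :
    aDegree (weights T) u = 15 * u 0 + 10 * u 1 + 6 * (T * u 2) := by
  simp only [aDegree, weights, Fin.sum_univ_three, Matrix.cons_val_zero, Matrix.cons_val_one,
    Matrix.cons_val]
  ring

/-- The lattice of `A`-homogeneous exponent differences. -/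
lemma exists_lattice_coordinates {T : ℕ} (hT : ¬ 5 ∣ T) {u v : Fin 3 →₀ ℕ}
    (h : aDegree (weights T) u = aDegree (weights T) v) :
    ∃ p q r : ℤ, (u 0 : ℤ) = v 0 + 2 * p ∧ (u 1 : ℤ) = v 1 + 3 * q ∧ (u 2 : ℤ) = v 2 + 5 * r ∧
      p + q + T * r = 0 := by
  rw [aDegree_weights, aDegree_weights] at h
  -- Modulo 5 the weights are 0, 0 and T.
  have h5 : (5 : ℤ) ∣ T * (u 2 - v 2) := by
    rw [mul_sub]
    zify at h
    omega
  have h5' : (5 : ℤ) ∣ u 2 - v 2 := by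
    refine (Int.Prime.dvd_mul' (p := 5) (by norm_num) (by exact_mod_cast h5)).resolve_left ?_
    exact_mod_cast hT
  obtain ⟨r, hr⟩ := h5'
  have hTr : (T : ℤ) * u 2 - T * v 2 = 5 * (T * r) := by rw [← mul_sub, hr]; ring
  zify at h
  -- Dividing the relation by 5 leaves coefficients 3, 2 and 6Tr, so both quotients are exact.
  exact ⟨(u 0 - v 0) / 2, (u 1 - v 1) / 3, r, by omega, by omega, by omega, by omega⟩

end Exponents

/-! ### The Graver basis -/

section Family

variable {K : Type*} [Field K] {T : ℕ}

/-- The binomial `x² - y³`. -/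
noncomputable def pureBinom (K : Type*) [Field K] : MvPolynomial (Fin 3) K :=
  binom K (tri 2 0 0) (tri 0 3 0)

/-- The binomial `z⁵ - x²ⁱ y³ʲ`. -/
noncomputable def mixedBinom (K : Type*) [Field K] (i j : ℕ) : MvPolynomial (Fin 3) K :=
  binom K (tri 0 0 5) (tri (2 * i) (3 * j) 0)

/-- The elements of the Graver basis, up to sign. -/
def primitives (K : Type*) [Field K] (T : ℕ) : Set (MvPolynomial (Fin 3) K) :=
  insert (pureBinom K) {f | ∃ i j, i + j = T ∧ f = mixedBinom K i j}

lemma tri_pure_ne : tri 2 0 0 ≠ tri 0 3 0 := fun h => by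
  simpa using DFunLike.congr_fun h 0

lemma tri_mixed_ne (i j : ℕ) : tri 0 0 5 ≠ tri (2 * i) (3 * j) 0 := fun h => by
  simpa using DFunLike.congr_fun h 2

lemma aDegree_pure (T : ℕ) :
    aDegree (weights T) (tri 2 0 0) = aDegree (weights T) (tri 0 3 0) := by
  simp [aDegree_weights]

lemma aDegree_mixed {i j : ℕ} (h : i + j = T) :
    aDegree (weights T) (tri 0 0 5) = aDegree (weights T) (tri (2 * i) (3 * j) 0) := by
  subst h
  simp only [aDegree_weights, tri_zero, tri_one, tri_two]
  ring

lemma isBinomialOf_pure : IsBinomialOf K (weights T) (tri 2 0 0) (tri 0 3 0) :=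
  isBinomialOf_iff.2 ⟨tri_pure_ne, aDegree_pure T⟩

lemma isBinomialOf_mixed {i j : ℕ} (h : i + j = T) :
    IsBinomialOf K (weights T) (tri 0 0 5) (tri (2 * i) (3 * j) 0) :=
  isBinomialOf_iff.2 ⟨tri_mixed_ne i j, aDegree_mixed h⟩

lemma IsBinomialOf.swap {n : ℕ} {a : Fin n → ℕ} {u v : Fin n →₀ ℕ} (h : IsBinomialOf K a u v) :
    IsBinomialOf K a v u := by
  rw [isBinomialOf_iff] at h ⊢
  exact ⟨h.1.symm, h.2.symm⟩

/-- If p and q have strictly opposite signs, X - Y lies below the binomial up to sign. Otherwise |p|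
+ |q| = T|r|, and for r ≠ 0 this leaves room for some Z - XⁱYʲ below it. -/
lemma graverBasis_subset (hT : ¬ 5 ∣ T) {f : MvPolynomial (Fin 3) K}
    (hf : f ∈ graverBasis K (weights T)) : f ∈ primitives K T ∨ -f ∈ primitives K T := by
  obtain ⟨u, v, rfl, huv, hmin⟩ := hf
  obtain ⟨hne, hdeg⟩ := isBinomialOf_iff.1 huv
  obtain ⟨p, q, r, h0, h1, h2, h⟩ := exists_lattice_coordinates hT hdeg
  rw [neg_binom]
  by_cases hpq : 0 < p ∧ q < 0
  · obtain ⟨rfl, rfl⟩ := hmin _ _ isBinomialOf_pure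
      (exponents_le_iff.2 (by simp only [tri_zero, tri_one, tri_two]; omega))
      (exponents_le_iff.2 (by simp only [tri_zero, tri_one, tri_two]; omega))
    exact Or.inl (Or.inl rfl)
  by_cases hqp : p < 0 ∧ 0 < q
  · obtain ⟨rfl, rfl⟩ := hmin _ _ isBinomialOf_pure.swap
      (exponents_le_iff.2 (by simp only [tri_zero, tri_one, tri_two]; omega))
      (exponents_le_iff.2 (by simp only [tri_zero, tri_one, tri_two]; omega))
    exact Or.inr (Or.inl rfl)
  rcases lt_trichotomy r 0 with hr | rfl | hr
  · have hle : (T : ℤ) ≤ p + q := by nlinarith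
    -- Here p, q ≥ 0 and p + q ≥ T: take i as large as p allows, and then T - i ≤ q.
    have hij : min p.toNat T + (T - min p.toNat T) = T := by omega
    obtain ⟨h3, h4⟩ := hmin _ _ (isBinomialOf_mixed hij).swap
      (exponents_le_iff.2 (by simp only [tri_zero, tri_one, tri_two]; omega))
      (exponents_le_iff.2 (by simp only [tri_zero, tri_one, tri_two]; omega))
    exact Or.inr (Or.inr ⟨_, _, hij, by rw [mixedBinom, h3, h4]⟩)
  · exact absurd (exponents_ext (by omega) (by omega) (by omega)) hne
  · have hle : (T : ℤ) ≤ -p + -q := by nlinarith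
    have hij : min (-p).toNat T + (T - min (-p).toNat T) = T := by omega
    obtain ⟨h3, h4⟩ := hmin _ _ (isBinomialOf_mixed hij)
      (exponents_le_iff.2 (by simp only [tri_zero, tri_one, tri_two]; omega))
      (exponents_le_iff.2 (by simp only [tri_zero, tri_one, tri_two]; omega))
    exact Or.inl (Or.inr ⟨_, _, hij, by rw [mixedBinom, h3, h4]⟩)

/-- A binomial of `I_A` whose first monomial divides `z⁵` is some `z⁵ - x²ⁱ y³ʲ`. -/
lemma eq_mixed_of_le (hT : ¬ 5 ∣ T) {w z : Fin 3 →₀ ℕ} (h : IsBinomialOf K (weights T) w z)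
    (hw : w ≤ tri 0 0 5) : w = tri 0 0 5 ∧ ∃ i j, i + j = T ∧ z = tri (2 * i) (3 * j) 0 := by
  obtain ⟨hne, hdeg⟩ := isBinomialOf_iff.1 h
  obtain ⟨p, q, r, h0, h1, h2, h3⟩ := exists_lattice_coordinates hT hdeg
  simp only [exponents_le_iff, tri_zero, tri_one, tri_two] at hw
  -- No x or y in w gives p, q ≤ 0, so Tr ≥ 0, while the bound 5 on the z-exponent gives r ≤ 1. The
  -- case T = 0 is excluded because 5 ∣ 0.
  have hr : r = 1 := by
    by_contra hr
    have hr0 : r ≤ 0 := by omega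
    have h4 : (T : ℤ) * r ≤ 0 := mul_nonpos_of_nonneg_of_nonpos (by positivity) hr0
    have h5 : (T : ℤ) * r = 0 := by omega
    rcases mul_eq_zero.1 h5 with h6 | rfl
    · exact hT (by simp [Int.natCast_eq_zero.1 h6])
    · exact hne (exponents_ext (by omega) (by omega) (by omega))
  subst hr
  refine ⟨exponents_ext ?_ ?_ ?_, (-p).toNat, (-q).toNat, by omega, exponents_ext ?_ ?_ ?_⟩ <;>
    simp only [tri_zero, tri_one, tri_two] <;> omega

/-- A binomial of `I_A` whose first monomial divides `x²` is `x² - y³`. -/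
lemma eq_pure_of_le (hT : ¬ 5 ∣ T) (hT2 : 2 ≤ T) {w z : Fin 3 →₀ ℕ}
    (h : IsBinomialOf K (weights T) w z) (hw : w ≤ tri 2 0 0) :
    w = tri 2 0 0 ∧ z = tri 0 3 0 := by
  obtain ⟨hne, hdeg⟩ := isBinomialOf_iff.1 h
  obtain ⟨p, q, r, h0, h1, h2, h3⟩ := exists_lattice_coordinates hT hdeg
  simp only [exponents_le_iff, tri_zero, tri_one, tri_two] at hw
  -- With r ≤ -1 one gets p + q ≥ T ≥ 2, against p ≤ 1 and q ≤ 0. For T = 1 the binomial x² - z⁵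
  -- would be a counterexample.
  have hr : r = 0 := by
    by_contra hr
    have hr0 : r ≤ -1 := by omega
    nlinarith
  subst hr
  have hp : p = 1 := by
    by_contra hp
    exact hne (exponents_ext (by omega) (by omega) (by omega))
  subst hp
  refine ⟨exponents_ext ?_ ?_ ?_, exponents_ext ?_ ?_ ?_⟩ <;>
    simp only [tri_zero, tri_one, tri_two] <;> omega

lemma primitives_subset_graverBasis (hT : ¬ 5 ∣ T) (hT2 : 2 ≤ T) :
    primitives K T ⊆ graverBasis K (weights T) := by
  rintro f (rfl | ⟨i, j, hij, rfl⟩)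
  · exact ⟨_, _, rfl, isBinomialOf_pure, fun w z h hw _ => eq_pure_of_le hT hT2 h hw⟩
  · refine ⟨_, _, rfl, isBinomialOf_mixed hij, fun w z h hw hz => ?_⟩
    obtain ⟨rfl, i', j', hij', rfl⟩ := eq_mixed_of_le hT h hw
    simp only [exponents_le_iff, tri_zero, tri_one, tri_two] at hz
    obtain rfl : i' = i := by omega
    obtain rfl : j' = j := by omega
    exact ⟨rfl, rfl⟩

/-! ### The universal Gröbner basis -/

section Groebner

variable {m : MonomialOrder (Fin 3)}

lemma eq_zero_of_mul_lt {T r : ℤ} (h1 : -T < T * r) (h2 : T * r < T) : r = 0 := by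
  have hT : 0 < T := by omega
  have h3 : r < 1 := by
    by_contra h
    nlinarith
  have h4 : -1 < r := by
    by_contra h
    nlinarith
  omega

/-- With x² leading, only the comparison of z⁵ with y³ᵀ remains. Standard monomials have x-exponent
below 2, so p = 0, and either z-exponent below 5 or y-exponent below 3T; each forces r = 0 and hence
uniqueness. -/
lemma exists_isReducedGroebnerBasis_of_lt (hT : ¬ 5 ∣ T) (hT2 : 2 ≤ T)
    (h1 : m.toSyn (tri 0 3 0) < m.toSyn (tri 2 0 0)) :
    ∃ G, IsReducedGroebnerBasis m (toricIdeal K (weights T)) G ∧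
      toricIdeal K (weights T) = Ideal.span G ∧
      (G = {pureBinom K, mixedBinom K 0 T} ∨ G = {pureBinom K, -mixedBinom K 0 T}) := by
  have hdeg := aDegree_mixed (T := T) (zero_add T)
  rcases lt_trichotomy (m.toSyn (tri (2 * 0) (3 * T) 0)) (m.toSyn (tri 0 0 5)) with h2 | h2 | h2
  · have huniq : ∀ w w', aDegree (weights T) w = aDegree (weights T) w' →
        ¬ tri 2 0 0 ≤ w → ¬ tri 0 0 5 ≤ w → ¬ tri 2 0 0 ≤ w' → ¬ tri 0 0 5 ≤ w' → w = w' := by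
      intro w w' h hw1 hw2 hw1' hw2'
      obtain ⟨p, q, r, h3, h4, h5, h6⟩ := exists_lattice_coordinates hT h
      simp only [exponents_le_iff, tri_zero, tri_one, tri_two] at *
      obtain rfl : r = 0 := by omega
      exact exponents_ext (by omega) (by omega) (by omega)
    refine ⟨_, isReducedGroebnerBasis_pair h1 h2 (aDegree_pure T) hdeg huniq ?_ ?_ ?_ ?_,
      toricIdeal_eq_span_pair h1 h2 (aDegree_pure T) hdeg huniq, Or.inl rfl⟩
    all_goals simp [exponents_le_iff]
  · exact absurd (m.toSyn.injective h2) (tri_mixed_ne 0 T).symm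
  · have huniq : ∀ w w', aDegree (weights T) w = aDegree (weights T) w' →
        ¬ tri 2 0 0 ≤ w → ¬ tri (2 * 0) (3 * T) 0 ≤ w → ¬ tri 2 0 0 ≤ w' →
        ¬ tri (2 * 0) (3 * T) 0 ≤ w' → w = w' := by
      intro w w' h hw1 hw2 hw1' hw2'
      obtain ⟨p, q, r, h3, h4, h5, h6⟩ := exists_lattice_coordinates hT h
      simp only [exponents_le_iff, tri_zero, tri_one, tri_two] at *
      obtain rfl : p = 0 := by omega
      obtain rfl : r = 0 := eq_zero_of_mul_lt (T := T) (by omega) (by omega)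
      exact exponents_ext (by omega) (by omega) (by omega)
    refine ⟨_, isReducedGroebnerBasis_pair h1 h2 (aDegree_pure T) hdeg.symm huniq ?_ ?_ ?_ ?_,
      toricIdeal_eq_span_pair h1 h2 (aDegree_pure T) hdeg.symm huniq,
      Or.inr (by rw [pureBinom, mixedBinom, neg_binom])⟩
    all_goals
      simp only [exponents_le_iff, tri_zero, tri_one, tri_two]
      omega

lemma exists_isReducedGroebnerBasis_of_gt (hT : ¬ 5 ∣ T) (hT2 : 2 ≤ T)
    (h1 : m.toSyn (tri 2 0 0) < m.toSyn (tri 0 3 0)) :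
    ∃ G, IsReducedGroebnerBasis m (toricIdeal K (weights T)) G ∧
      (G = {-pureBinom K, mixedBinom K T 0} ∨ G = {-pureBinom K, -mixedBinom K T 0}) := by
  have hdeg := aDegree_mixed (T := T) (add_zero T)
  rcases lt_trichotomy (m.toSyn (tri (2 * T) (3 * 0) 0)) (m.toSyn (tri 0 0 5)) with h2 | h2 | h2
  · refine ⟨_, isReducedGroebnerBasis_pair h1 h2 (aDegree_pure T).symm hdeg ?_ ?_ ?_ ?_ ?_,
      Or.inl (by rw [pureBinom, mixedBinom, neg_binom])⟩
    · intro w w' h hw1 hw2 hw1' hw2'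
      obtain ⟨p, q, r, h3, h4, h5, h6⟩ := exists_lattice_coordinates hT h
      simp only [exponents_le_iff, tri_zero, tri_one, tri_two] at *
      obtain rfl : r = 0 := by omega
      exact exponents_ext (by omega) (by omega) (by omega)
    all_goals simp [exponents_le_iff]
  · exact absurd (m.toSyn.injective h2) (tri_mixed_ne T 0).symm
  · refine ⟨_, isReducedGroebnerBasis_pair h1 h2 (aDegree_pure T).symm hdeg.symm ?_ ?_ ?_ ?_ ?_,
      Or.inr (by rw [pureBinom, mixedBinom, neg_binom, neg_binom])⟩
    · intro w w' h hw1 hw2 hw1' hw2'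
      obtain ⟨p, q, r, h3, h4, h5, h6⟩ := exists_lattice_coordinates hT h
      simp only [exponents_le_iff, tri_zero, tri_one, tri_two] at *
      obtain rfl : q = 0 := by omega
      obtain rfl : r = 0 := eq_zero_of_mul_lt (T := T) (by omega) (by omega)
      exact exponents_ext (by omega) (by omega) (by omega)
    all_goals
      simp only [exponents_le_iff, tri_zero, tri_one, tri_two]
      omega

/-- Together with `degLex_pure_lt` this shows that both comparisons of x² and y³ occur, so both
mixed circuits are reached. -/
lemma lex_pure_lt : (MonomialOrder.lex (σ := Fin 3)).toSyn (tri 0 3 0) <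
    (MonomialOrder.lex (σ := Fin 3)).toSyn (tri 2 0 0) := by
  rw [MonomialOrder.lex_lt_iff, Finsupp.Lex.lt_iff]
  exact ⟨0, fun j hj => absurd hj (by simp), by simp⟩

lemma degLex_pure_lt : (MonomialOrder.degLex (σ := Fin 3)).toSyn (tri 2 0 0) <
    (MonomialOrder.degLex (σ := Fin 3)).toSyn (tri 0 3 0) := by
  rw [MonomialOrder.degLex_lt_iff, Finsupp.DegLex.lt_iff]
  left
  simp [Finsupp.degree_eq_sum, Fin.sum_univ_three]

end Groebner

/-- The circuits, up to sign. -/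
def circuitReps (K : Type*) [Field K] (T : ℕ) : Set (MvPolynomial (Fin 3) K) :=
  {pureBinom K, mixedBinom K 0 T, mixedBinom K T 0}

lemma universalGroebnerBasis_subset (hT : ¬ 5 ∣ T) (hT2 : 2 ≤ T) {f : MvPolynomial (Fin 3) K}
    (hf : f ∈ universalGroebnerBasis K (weights T)) :
    f ∈ circuitReps K T ∨ -f ∈ circuitReps K T := by
  obtain ⟨m, G, hG, hfG⟩ := hf
  rcases lt_trichotomy (m.toSyn (tri 0 3 0)) (m.toSyn (tri 2 0 0)) with h | h | h
  · obtain ⟨H, hH, -, rfl | rfl⟩ := exists_isReducedGroebnerBasis_of_lt (K := K) hT hT2 h <;>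
      rcases hG.subset hH hfG with rfl | rfl <;> simp [circuitReps]
  · exact absurd (m.toSyn.injective h) tri_pure_ne.symm
  · obtain ⟨H, hH, rfl | rfl⟩ := exists_isReducedGroebnerBasis_of_gt (K := K) hT hT2 h <;>
      rcases hG.subset hH hfG with rfl | rfl <;> simp [circuitReps]

lemma circuitReps_subset_universalGroebnerBasis (hT : ¬ 5 ∣ T) (hT2 : 2 ≤ T)
    {f : MvPolynomial (Fin 3) K} (hf : f ∈ circuitReps K T) :
    f ∈ universalGroebnerBasis K (weights T) ∨ -f ∈ universalGroebnerBasis K (weights T) := by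
  obtain ⟨G, hG, -, hG'⟩ := exists_isReducedGroebnerBasis_of_lt (K := K) hT hT2 lex_pure_lt
  obtain ⟨H, hH, hH'⟩ := exists_isReducedGroebnerBasis_of_gt (K := K) hT hT2 degLex_pure_lt
  have hGU : G ⊆ universalGroebnerBasis K (weights T) := fun g hg => ⟨_, G, hG, hg⟩
  have hHU : H ⊆ universalGroebnerBasis K (weights T) := fun g hg => ⟨_, H, hH, hg⟩
  rcases hf with rfl | rfl | rfl
  · rcases hG' with rfl | rfl <;> exact Or.inl (hGU (by simp))
  · rcases hG' with rfl | rfl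
    · exact Or.inl (hGU (by simp))
    · exact Or.inr (hGU (by simp))
  · rcases hH' with rfl | rfl
    · exact Or.inl (hHU (by simp))
    · exact Or.inr (hHU (by simp))

/-- Modulo X - Y, every XᵏYˡ is congruent to Yᵏ⁺ˡ, so any one mixed binomial yields Z - Yᵀ, and the
lex Gröbner basis generates. -/
lemma toricIdeal_le_of_mem (hT : ¬ 5 ∣ T) (hT2 : 2 ≤ T) {J : Ideal (MvPolynomial (Fin 3) K)}
    (hp : pureBinom K ∈ J) {i j : ℕ} (hij : i + j = T) (hm : mixedBinom K i j ∈ J) :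
    toricIdeal K (weights T) ≤ J := by
  have hxy : ∀ k l, binom K (tri (2 * k) (3 * l) 0) (tri (2 * 0) (3 * (k + l)) 0) ∈ J := by
    intro k
    induction k with
    | zero => simp [binom]
    | succ k ih =>
      intro l
      have h1 : tri (2 * (k + 1)) (3 * l) 0 = tri (2 * k) (3 * l) 0 + tri 2 0 0 :=
        exponents_ext (by simp; ring) (by simp) (by simp)
      have h2 : tri (2 * k) (3 * (l + 1)) 0 = tri (2 * k) (3 * l) 0 + tri 0 3 0 :=
        exponents_ext (by simp) (by simp; ring) (by simp)
      rw [← binom_add_binom _ (tri (2 * k) (3 * (l + 1)) 0), add_right_comm, add_assoc k]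
      refine J.add_mem ?_ (ih (l + 1))
      rw [h1, h2, ← monomial_mul_binom]
      exact J.mul_mem_left _ hp
  have hm' : mixedBinom K 0 T ∈ J := by
    subst hij
    rw [mixedBinom, ← binom_add_binom _ (tri (2 * i) (3 * j) 0)]
    exact J.add_mem hm (hxy i j)
  obtain ⟨G, -, hspan, rfl | rfl⟩ := exists_isReducedGroebnerBasis_of_lt (K := K) hT hT2 lex_pure_lt
  all_goals
    rw [hspan]
    refine Ideal.span_le.2 ?_
    rintro f (rfl | rfl)
    · exact hp
  · exact hm'
  · exact J.neg_mem hm'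

/-! ### The universal Markov basis -/

section Markov

lemma isBinomialGeneratingSet_pair (hT : ¬ 5 ∣ T) (hT2 : 2 ≤ T) {i j : ℕ} (hij : i + j = T) :
    IsBinomialGeneratingSet K (weights T) {pureBinom K, mixedBinom K i j} := by
  refine ⟨?_, le_antisymm (Ideal.span_le.2 ?_) (toricIdeal_le_of_mem hT hT2
    (Ideal.subset_span (by simp)) hij (Ideal.subset_span (by simp)))⟩
  · rintro f (rfl | rfl)
    · exact ⟨_, _, tri_pure_ne, rfl⟩
    · exact ⟨_, _, tri_mixed_ne i j, rfl⟩
  · rintro f (rfl | rfl)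
    · exact isBinomialOf_pure.2
    · exact (isBinomialOf_mixed hij).2

/-- Some element of B has a monomial dividing x², and some element one dividing z⁵; up to sign these
are X - Y and a Z - XⁱYʲ. They already generate, so minimality leaves nothing else in B. -/
lemma universalMarkovBasis_subset (hT : ¬ 5 ∣ T) (hT2 : 2 ≤ T) {f : MvPolynomial (Fin 3) K}
    (hf : f ∈ universalMarkovBasis K (weights T)) :
    f ∈ primitives K T ∨ -f ∈ primitives K T := by
  obtain ⟨B, ⟨⟨hB, hspan⟩, hmin⟩, hfB⟩ := hf
  have hmem : ∀ u v, binom K u v ∈ B ∨ binom K v u ∈ B → binom K u v ∈ toricIdeal K (weights T) := by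
    rintro u v (h | h)
    · exact hspan ▸ Ideal.subset_span h
    · rw [← neg_binom, Ideal.neg_mem_iff]
      exact hspan ▸ Ideal.subset_span h
  have hpure : pureBinom K ∈ B ∨ -pureBinom K ∈ B := by
    obtain ⟨u, v, huv, hle, h⟩ := exists_le_of_mem_span_binomials hB
      (f := pureBinom K) (m := tri 2 0 0)
      (hspan ▸ (isBinomialOf_pure (T := T)).2) (by
        rw [pureBinom, coeff_binom_left tri_pure_ne]; exact one_ne_zero)
    obtain ⟨rfl, rfl⟩ := eq_pure_of_le hT hT2 ⟨huv, hmem u v h⟩ hle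
    rwa [pureBinom, neg_binom]
  have hmixed : ∃ i j, i + j = T ∧ (mixedBinom K i j ∈ B ∨ -mixedBinom K i j ∈ B) := by
    obtain ⟨u, v, huv, hle, h⟩ := exists_le_of_mem_span_binomials hB
      (f := mixedBinom K T 0) (m := tri 0 0 5)
      (hspan ▸ (isBinomialOf_mixed (add_zero T)).2) (by
        rw [mixedBinom, coeff_binom_left (tri_mixed_ne T 0)]; exact one_ne_zero)
    obtain ⟨rfl, i, j, hij, rfl⟩ := eq_mixed_of_le hT ⟨huv, hmem u v h⟩ hle
    refine ⟨i, j, hij, ?_⟩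
    rwa [mixedBinom, neg_binom]
  obtain ⟨i, j, hij, hmixed⟩ := hmixed
  let B' : Set (MvPolynomial (Fin 3) K) :=
    {g | g ∈ B ∧ (g = pureBinom K ∨ -g = pureBinom K ∨ g = mixedBinom K i j ∨
      -g = mixedBinom K i j)}
  have hB'B : B' ⊆ B := fun g hg => hg.1
  have hgen : IsBinomialGeneratingSet K (weights T) B' := by
    refine ⟨fun g hg => hB g hg.1, le_antisymm (hspan ▸ Ideal.span_mono hB'B)
      (toricIdeal_le_of_mem hT hT2 ?_ hij ?_)⟩
    · rcases hpure with h | h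
      · exact Ideal.subset_span ⟨h, by simp⟩
      · exact (Ideal.neg_mem_iff _).1 (Ideal.subset_span ⟨h, by simp⟩)
    · rcases hmixed with h | h
      · exact Ideal.subset_span ⟨h, by simp⟩
      · exact (Ideal.neg_mem_iff _).1 (Ideal.subset_span ⟨h, by simp⟩)
  have hBB' : B' = B := by
    by_contra hne
    exact hmin B' (hB'B.ssubset_of_ne hne) hgen
  rw [← hBB'] at hfB
  rcases hfB.2 with h | h | h | h
  · exact Or.inl (Or.inl h)
  · exact Or.inr (Or.inl h)
  · exact Or.inl (Or.inr ⟨i, j, hij, h⟩)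
  · exact Or.inr (Or.inr ⟨i, j, hij, h⟩)

lemma eval_binom (x : Fin 3 → K) (u v : Fin 3 →₀ ℕ) :
    eval x (binom K u v) =
      x 0 ^ u 0 * x 1 ^ u 1 * x 2 ^ u 2 - x 0 ^ v 0 * x 1 ^ v 1 * x 2 ^ v 2 := by
  simp [binom, eval_monomial, Finsupp.prod_fintype, Fin.prod_univ_three]

lemma notMem_span_singleton_of_eval {f g : MvPolynomial (Fin 3) K} (x : Fin 3 → K)
    (hf : eval x f ≠ 0) (hg : eval x g = 0) : f ∉ Ideal.span {g} := by
  intro h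
  obtain ⟨c, rfl⟩ := Ideal.mem_span_singleton'.1 h
  simp [hg] at hf

lemma mixed_notMem_span_pure (hT2 : 2 ≤ T) {i j : ℕ} (hij : i + j = T) :
    mixedBinom K i j ∉ Ideal.span {pureBinom K} := by
  -- At (0, 0, 1) every mixed binomial is 1, since i + j > 0.
  refine notMem_span_singleton_of_eval ![0, 0, 1] ?_ ?_
  · rcases Nat.eq_zero_or_pos i with rfl | hi
    · obtain rfl : j = T := by omega
      simp [mixedBinom, eval_binom, show j ≠ 0 by omega]
    · simp [mixedBinom, eval_binom, hi.ne']
  · simp [pureBinom, eval_binom]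

/-- The mixed binomial vanishes at (1, 0, 0) if i = 0 and at (0, 1, 0) if i > 0, whereas X - Y is ±1
there. -/
lemma pure_notMem_span_mixed (hT2 : 2 ≤ T) {i j : ℕ} (hij : i + j = T) :
    pureBinom K ∉ Ideal.span {mixedBinom K i j} := by
  rcases Nat.eq_zero_or_pos i with rfl | hi
  · obtain rfl : j = T := by omega
    refine notMem_span_singleton_of_eval ![1, 0, 0] ?_ ?_ <;>
      simp [pureBinom, mixedBinom, eval_binom, show j ≠ 0 by omega]
  · refine notMem_span_singleton_of_eval ![0, 1, 0] ?_ ?_ <;>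
      simp [pureBinom, mixedBinom, eval_binom, hi.ne']

lemma isMarkovBasis_pair (hT : ¬ 5 ∣ T) (hT2 : 2 ≤ T) {i j : ℕ} (hij : i + j = T) :
    IsMarkovBasis K (weights T) {pureBinom K, mixedBinom K i j} := by
  refine ⟨isBinomialGeneratingSet_pair hT hT2 hij, fun B' hB' hgen => ?_⟩
  have hp : pureBinom K ∈ Ideal.span B' := hgen.2 ▸ (isBinomialOf_pure (T := T)).2
  have hm : mixedBinom K i j ∈ Ideal.span B' := hgen.2 ▸ (isBinomialOf_mixed hij).2
  obtain ⟨g, hg, hgB'⟩ := Set.exists_of_ssubset hB'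
  rcases hg with rfl | rfl
  · refine pure_notMem_span_mixed hT2 hij (Ideal.span_mono (fun f hf => ?_) hp)
    exact (hB'.1 hf).resolve_left fun h => hgB' (h ▸ hf)
  · refine mixed_notMem_span_pure hT2 hij (Ideal.span_mono (fun f hf => ?_) hm)
    exact (hB'.1 hf).resolve_right fun h => hgB' (h ▸ hf)

lemma primitives_subset_universalMarkovBasis (hT : ¬ 5 ∣ T) (hT2 : 2 ≤ T) :
    primitives K T ⊆ universalMarkovBasis K (weights T) := by
  rintro f (rfl | ⟨i, j, hij, rfl⟩)
  · exact ⟨_, isMarkovBasis_pair hT hT2 (add_zero T), by simp⟩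
  · exact ⟨_, isMarkovBasis_pair hT hT2 hij, by simp⟩

end Markov

/-! ### The circuits -/

section Circuits

lemma two_le_card_support (hT0 : 0 < T) {u v : Fin 3 →₀ ℕ}
    (h : IsBinomialOf K (weights T) u v) : 2 ≤ (u.support ∪ v.support).card := by
  by_contra hlt
  obtain ⟨hne, hdeg⟩ := isBinomialOf_iff.1 h
  obtain ⟨k, hk⟩ := Finset.card_le_one_iff_subset_singleton.1
    (show (u.support ∪ v.support).card ≤ 1 by omega)
  have hzero : ∀ i, i ≠ k → u i = 0 ∧ v i = 0 := by
    intro i hi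
    by_contra hcon
    refine hi (Finset.mem_singleton.1 (hk ?_))
    simp only [Finset.mem_union, Finsupp.mem_support_iff]
    tauto
  have hcancel : T * u 2 = T * v 2 → u 2 = v 2 := Nat.eq_of_mul_eq_mul_left hT0
  rw [aDegree_weights, aDegree_weights] at hdeg
  fin_cases k
  · obtain ⟨h1, h1'⟩ := hzero 1 (by decide)
    obtain ⟨h2, h2'⟩ := hzero 2 (by decide)
    rw [h1, h1', h2, h2'] at hdeg
    exact hne (exponents_ext (by omega) (by omega) (by omega))
  · obtain ⟨h1, h1'⟩ := hzero 0 (by decide)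
    obtain ⟨h2, h2'⟩ := hzero 2 (by decide)
    rw [h1, h1', h2, h2'] at hdeg
    exact hne (exponents_ext (by omega) (by omega) (by omega))
  · obtain ⟨h1, h1'⟩ := hzero 0 (by decide)
    obtain ⟨h2, h2'⟩ := hzero 1 (by decide)
    rw [h1, h1', h2, h2'] at hdeg
    exact hne (exponents_ext (by omega) (by omega) (hcancel (by omega)))

/-- Full support is not minimal because of X - Y, so a variable is missing. The lattice relation
then makes all entries multiples of one parameter, which coprimality forces to be ±1. -/
lemma circuits_subset (hT : ¬ 5 ∣ T) {f : MvPolynomial (Fin 3) K}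
    (hf : f ∈ circuits K (weights T)) : f ∈ circuitReps K T ∨ -f ∈ circuitReps K T := by
  obtain ⟨u, v, rfl, huv, ⟨hdisj, hgcd⟩, hmin⟩ := hf
  obtain ⟨hne, hdeg⟩ := isBinomialOf_iff.1 huv
  have hd : ∀ i, u i = 0 ∨ v i = 0 := by
    intro i
    by_contra! hcon
    exact Finset.disjoint_left.1 hdisj (Finsupp.mem_support_iff.2 hcon.1)
      (Finsupp.mem_support_iff.2 hcon.2)
  have hunit : ∀ t : ℤ, t ∣ u 0 + v 0 → t ∣ u 1 + v 1 → t ∣ u 2 + v 2 → t = 1 ∨ t = -1 := by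
    intro t h0 h1 h2
    rw [← Int.isUnit_iff, Int.isUnit_iff_natAbs_eq, ← Nat.dvd_one, ← hgcd]
    refine Finset.dvd_gcd fun i _ => ?_
    rw [← Int.natCast_dvd_natCast, Int.natAbs_dvd]
    push_cast
    fin_cases i <;> assumption
  have hmiss : ∃ i, u i = 0 ∧ v i = 0 := by
    by_contra! hcon
    have huniv : u.support ∪ v.support = Finset.univ := by
      ext i
      simp only [Finset.mem_union, Finsupp.mem_support_iff, Finset.mem_univ, iff_true]
      have := hcon i
      tauto
    refine hmin ⟨_, _, isBinomialOf_pure, ?_⟩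
    rw [huniv, Finset.ssubset_univ_iff]
    intro h
    have h2 := Finset.mem_univ (2 : Fin 3)
    rw [← h] at h2
    simp at h2
  obtain ⟨p, q, r, h0, h1, h2, h3⟩ := exists_lattice_coordinates hT hdeg
  have d0 := hd 0
  have d1 := hd 1
  have d2 := hd 2
  have key : ∀ k c : ℤ, ∀ x y : ℕ, (x : ℤ) = y + c * k → (x = 0 ∨ y = 0) → k ∣ x + y := by
    rintro k c x y hxy (rfl | rfl)
    · exact ⟨-c, by push_cast at hxy ⊢; linarith⟩
    · exact ⟨c, by push_cast at hxy ⊢; linarith⟩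
  have e2 := key r 5 _ _ (by omega) d2
  rw [neg_binom]
  obtain ⟨i, hi, hi'⟩ := hmiss
  fin_cases i
  · replace hi : u 0 = 0 := hi
    replace hi' : v 0 = 0 := hi'
    have hq : q = -(T * r) := by omega
    have e1 := key r (-(3 * T)) _ _ (by rw [h1, hq]; ring) d1
    rcases hunit r (by simp [hi, hi']) e1 e2 with rfl | rfl
    · left
      right; left
      rw [mixedBinom]
      congr 1 <;> refine exponents_ext ?_ ?_ ?_ <;> simp only [tri_zero, tri_one, tri_two] <;> omega
    · right
      right; left
      rw [mixedBinom]
      congr 1 <;> refine exponents_ext ?_ ?_ ?_ <;> simp only [tri_zero, tri_one, tri_two] <;> omega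
  · replace hi : u 1 = 0 := hi
    replace hi' : v 1 = 0 := hi'
    have hp : p = -(T * r) := by omega
    have e0 := key r (-(2 * T)) _ _ (by rw [h0, hp]; ring) d0
    rcases hunit r e0 (by simp [hi, hi']) e2 with rfl | rfl
    · left
      right; right
      change _ = mixedBinom K T 0
      rw [mixedBinom]
      congr 1 <;> refine exponents_ext ?_ ?_ ?_ <;> simp only [tri_zero, tri_one, tri_two] <;> omega
    · right
      right; right
      change _ = mixedBinom K T 0
      rw [mixedBinom]
      congr 1 <;> refine exponents_ext ?_ ?_ ?_ <;> simp only [tri_zero, tri_one, tri_two] <;> omega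
  · replace hi : u 2 = 0 := hi
    replace hi' : v 2 = 0 := hi'
    obtain rfl : r = 0 := by omega
    have e0 := key p 2 _ _ h0 d0
    have e1 := key p (-3) _ _ (by omega) d1
    rcases hunit p e0 e1 (by simp [hi, hi']) with rfl | rfl
    · left
      left
      rw [pureBinom]
      congr 1 <;> refine exponents_ext ?_ ?_ ?_ <;> simp only [tri_zero, tri_one, tri_two] <;> omega
    · right
      left
      rw [pureBinom]
      congr 1 <;> refine exponents_ext ?_ ?_ ?_ <;> simp only [tri_zero, tri_one, tri_two] <;> omega

/-- A missing variable leaves at most two in the support, and no binomial of `I_A` uses fewer than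
two. -/
lemma binom_mem_circuits (hT0 : 0 < T) {u v : Fin 3 →₀ ℕ} (h : IsBinomialOf K (weights T) u v)
    (hd : ∀ i, u i = 0 ∨ v i = 0) {i j : Fin 3} (hij : (u i + v i).Coprime (u j + v j))
    {k : Fin 3} (hk : u k = 0 ∧ v k = 0) : binom K u v ∈ circuits K (weights T) := by
  refine ⟨u, v, rfl, h, ⟨?_, ?_⟩, ?_⟩
  · rw [Finset.disjoint_left]
    intro l hu hv
    exact (hd l).elim (Finsupp.mem_support_iff.1 hu) (Finsupp.mem_support_iff.1 hv)
  · rw [← Nat.dvd_one, ← hij.gcd_eq_one]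
    exact Nat.dvd_gcd (Finset.gcd_dvd (Finset.mem_univ i)) (Finset.gcd_dvd (Finset.mem_univ j))
  · rintro ⟨u', v', h', hlt⟩
    have h1 := two_le_card_support hT0 h'
    have h2 := Finset.card_lt_card hlt
    have h3 : u.support ∪ v.support ⊂ Finset.univ := by
      rw [Finset.ssubset_univ_iff]
      intro h4
      have h5 := Finset.mem_univ k
      rw [← h4] at h5
      simp [hk] at h5
    have h4 := Finset.card_lt_card h3
    rw [Finset.card_univ, Fintype.card_fin] at h4
    omega

lemma circuitReps_subset_circuits (hT : ¬ 5 ∣ T) (hT0 : 0 < T) :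
    circuitReps K T ⊆ circuits K (weights T) := by
  have h5 : Nat.Coprime 5 T := (Nat.Prime.coprime_iff_not_dvd (by norm_num)).2 hT
  rintro f (rfl | rfl | rfl)
  · refine binom_mem_circuits hT0 isBinomialOf_pure (fun i => ?_) (i := 0) (j := 1) ?_ (k := 2) ?_
    · fin_cases i <;> simp
    · norm_num
    · simp
  · refine binom_mem_circuits hT0 (isBinomialOf_mixed (zero_add T)) (fun i => ?_) (i := 2) (j := 1)
      ?_ (k := 0) ?_
    · fin_cases i <;> simp
    · simpa using Nat.Coprime.mul_right (by norm_num : Nat.Coprime 5 3) h5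
    · simp
  · refine binom_mem_circuits hT0 (isBinomialOf_mixed (add_zero T)) (fun i => ?_) (i := 2) (j := 0)
      ?_ (k := 1) ?_
    · fin_cases i <;> simp
    · simpa using Nat.Coprime.mul_right (by norm_num : Nat.Coprime 5 2) h5
    · simp

end Circuits

/-! ### Counting up to sign -/

section Size

lemma upToSign_graverBasis (hT : ¬ 5 ∣ T) (hT2 : 2 ≤ T) :
    upToSign (graverBasis K (weights T)) = upToSign (primitives K T) :=
  upToSign_eq (fun _ hf => graverBasis_subset hT hf)
    fun _ hf => Or.inl (primitives_subset_graverBasis hT hT2 hf)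

lemma upToSign_universalMarkovBasis (hT : ¬ 5 ∣ T) (hT2 : 2 ≤ T) :
    upToSign (universalMarkovBasis K (weights T)) = upToSign (primitives K T) :=
  upToSign_eq (fun _ hf => universalMarkovBasis_subset hT hT2 hf)
    fun _ hf => Or.inl (primitives_subset_universalMarkovBasis hT hT2 hf)

lemma upToSign_universalGroebnerBasis (hT : ¬ 5 ∣ T) (hT2 : 2 ≤ T) :
    upToSign (universalGroebnerBasis K (weights T)) = upToSign (circuitReps K T) :=
  upToSign_eq (fun _ hf => universalGroebnerBasis_subset hT hT2 hf)
    fun _ hf => circuitReps_subset_universalGroebnerBasis hT hT2 hf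

lemma upToSign_circuits (hT : ¬ 5 ∣ T) (hT0 : 0 < T) :
    upToSign (circuits K (weights T)) = upToSign (circuitReps K T) :=
  upToSign_eq (fun _ hf => circuits_subset hT hf)
    fun _ hf => Or.inl (circuitReps_subset_circuits hT hT0 hf)

lemma primitives_finite : (primitives K T).Finite := by
  refine Set.Finite.insert _ (((Set.finite_Iic T).image fun i => mixedBinom K i (T - i)).subset ?_)
  rintro f ⟨i, j, h, rfl⟩
  exact ⟨i, Set.mem_Iic.2 (by omega), by simp only [show T - i = j by omega]⟩

lemma graverBasis_finite (hT : ¬ 5 ∣ T) : (graverBasis K (weights T)).Finite := by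
  refine ((primitives_finite (T := T)).union ((primitives_finite (T := T)).image Neg.neg)).subset fun f hf => ?_
  rcases graverBasis_subset hT hf with h | h
  · exact Or.inl h
  · exact Or.inr ⟨-f, h, neg_neg f⟩

lemma support_eq_of_pair_eq {f g : MvPolynomial (Fin 3) K}
    (h : ({f, -f} : Set (MvPolynomial (Fin 3) K)) = {g, -g}) : f.support = g.support := by
  have hf : f ∈ ({g, -g} : Set (MvPolynomial (Fin 3) K)) := h ▸ Set.mem_insert f _
  rcases hf with rfl | rfl
  · rfl
  · exact support_neg _

/-- The support is insensitive to sign, and its x-exponent 2i determines i. -/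
lemma mixed_pair_injective {i j i' j' : ℕ}
    (h : ({mixedBinom K i j, -mixedBinom K i j} : Set (MvPolynomial (Fin 3) K)) =
      {mixedBinom K i' j', -mixedBinom K i' j'}) : i = i' := by
  have h1 := support_eq_of_pair_eq h
  rw [mixedBinom, mixedBinom, support_binom (tri_mixed_ne i j),
    support_binom (tri_mixed_ne i' j')] at h1
  have h2 : tri (2 * i) (3 * j) 0 ∈ ({tri 0 0 5, tri (2 * i') (3 * j') 0} : Finset _) :=
    h1 ▸ (by simp)
  rw [Finset.mem_insert, Finset.mem_singleton] at h2
  have h3 := DFunLike.congr_fun (h2.resolve_left (tri_mixed_ne i j).symm) 0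
  simpa using h3

lemma pure_pair_ne_mixed_pair (i j : ℕ) :
    ({pureBinom K, -pureBinom K} : Set (MvPolynomial (Fin 3) K)) ≠
      {mixedBinom K i j, -mixedBinom K i j} := by
  intro h
  have h1 := support_eq_of_pair_eq h
  rw [mixedBinom, pureBinom, support_binom (tri_mixed_ne i j), support_binom tri_pure_ne] at h1
  have h2 : tri 0 0 5 ∈ ({tri 2 0 0, tri 0 3 0} : Finset _) := h1 ▸ (by simp)
  rw [Finset.mem_insert, Finset.mem_singleton] at h2
  rcases h2 with h2 | h2 <;> simpa using DFunLike.congr_fun h2 2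

lemma ncard_upToSign_circuitReps (hT0 : 0 < T) : (upToSign (circuitReps K T)).ncard = 3 := by
  rw [upToSign, circuitReps, Set.image_insert_eq, Set.image_pair, Set.ncard_eq_three]
  exact ⟨_, _, _, pure_pair_ne_mixed_pair _ _, pure_pair_ne_mixed_pair _ _,
    fun h => hT0.ne (mixed_pair_injective h), rfl⟩

lemma le_ncard_upToSign_primitives : T ≤ (upToSign (primitives K T)).ncard := by
  have hinj : Function.Injective fun i : ℕ =>
      ({mixedBinom K i (T - i), -mixedBinom K i (T - i)} : Set (MvPolynomial (Fin 3) K)) :=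
    fun i i' h => mixed_pair_injective h
  have hsub : (fun i : ℕ => ({mixedBinom K i (T - i), -mixedBinom K i (T - i)} :
      Set (MvPolynomial (Fin 3) K))) '' (Finset.range T : Set ℕ) ⊆ upToSign (primitives K T) := by
    rintro _ ⟨i, hi, rfl⟩
    have hi' := Finset.mem_range.1 (Finset.mem_coe.1 hi)
    exact ⟨_, Or.inr ⟨i, T - i, by omega, rfl⟩, rfl⟩
  have h := Set.ncard_le_ncard hsub (primitives_finite.image _)
  rwa [Set.ncard_image_of_injective _ hinj, Set.ncard_coe_finset, Finset.card_range] at h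

end Size

/-! ### Minimal generation of the semigroup -/

lemma isMinimalNumericalGenerators_weights (hT : ¬ 5 ∣ T) :
    IsMinimalNumericalGenerators (weights T) := by
  -- Applied with d = 2, 3, 5 for 15, 10, 6T: each prime divides the other two generators only.
  have hdvd : ∀ (d : ℕ) (i : Fin 3), (∀ j, j ≠ i → d ∣ weights T j) → ¬ d ∣ weights T i →
      weights T i ∉ AddSubmonoid.closure (weights T '' {j | j ≠ i}) := by
    intro d i hj hi hmem
    refine hi (AddSubmonoid.closure_induction (motive := fun x _ => d ∣ x) ?_ (dvd_zero d)
      (fun _ _ _ _ => dvd_add) hmem)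
    rintro _ ⟨j, hji, rfl⟩
    exact hj j hji
  refine ⟨?_, fun i => ?_⟩
  · have h0 : Finset.univ.gcd (weights T) ∣ 15 := Finset.gcd_dvd (Finset.mem_univ 0)
    have h1 : Finset.univ.gcd (weights T) ∣ 10 := Finset.gcd_dvd (Finset.mem_univ 1)
    have h2 : Finset.univ.gcd (weights T) ∣ 6 * T := Finset.gcd_dvd (Finset.mem_univ 2)
    have h3 : Finset.univ.gcd (weights T) ∣ 5 := Nat.dvd_gcd h0 h1
    rcases (Nat.dvd_prime (by norm_num)).1 h3 with h | h
    · exact h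
    · rw [h] at h2
      exact absurd h2 (by omega)
  · fin_cases i
    · refine hdvd 2 _ (fun j hj => ?_) (by simp [weights])
      fin_cases j
      · exact absurd rfl hj
      · norm_num [weights]
      · exact ⟨3 * T, by simp [weights]; ring⟩
    · refine hdvd 3 _ (fun j hj => ?_) (by simp [weights])
      fin_cases j
      · norm_num [weights]
      · exact absurd rfl hj
      · exact ⟨2 * T, by simp [weights]; ring⟩
    · refine hdvd 5 _ (fun j hj => ?_) (by simp only [weights]; change ¬ 5 ∣ 6 * T; omega)
      fin_cases j
      · norm_num [weights]
      · norm_num [weights]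
      · exact absurd rfl hj

lemma weights_pos (hT0 : 0 < T) (i : Fin 3) : 0 < weights T i := by
  fin_cases i <;> simp [weights, hT0]

lemma weights_injective (hT : ¬ 5 ∣ T) : Function.Injective (weights T) := by
  intro i j h
  by_contra hne
  exact (isMinimalNumericalGenerators_weights hT).2 i
    (AddSubmonoid.subset_closure ⟨j, Ne.symm hne, h.symm⟩)

end Family

end ToricBases

/-! ### The main theorem -/

theorem corollary4p3 (K : Type*) [Field K] :
    -- the 3-generated numerical semigroups
    (∀ N : ℕ, ∃ a : Fin 3 → ℕ, ToricBases.IsMinimalNumericalGenerators a ∧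
      ToricBases.upToSign (ToricBases.universalGroebnerBasis K a) =
        ToricBases.upToSign (ToricBases.circuits K a) ∧
      ToricBases.size (ToricBases.universalGroebnerBasis K a) = 3 ∧
      ToricBases.upToSign (ToricBases.graverBasis K a) =
        ToricBases.upToSign (ToricBases.universalMarkovBasis K a) ∧
      (ToricBases.graverBasis K a).Finite ∧
      N ≤ ToricBases.size (ToricBases.graverBasis K a)) ∧
    -- the Graver basis is not bounded in terms of the universal Gröbner basis
    (¬ ∃ F : ℕ → ℕ, ∀ (n : ℕ) (a : Fin n → ℕ), Function.Injective a → (∀ i, 0 < a i) →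
      ToricBases.size (ToricBases.graverBasis K a) ≤
        F (ToricBases.size (ToricBases.universalGroebnerBasis K a))) ∧
    -- the Graver basis is not bounded in terms of the circuits
    (¬ ∃ F : ℕ → ℕ, ∀ (n : ℕ) (a : Fin n → ℕ), Function.Injective a → (∀ i, 0 < a i) →
      ToricBases.size (ToricBases.graverBasis K a) ≤
        F (ToricBases.size (ToricBases.circuits K a))) ∧
    -- the universal Markov basis is not bounded in terms of the universal Gröbner basis
    (¬ ∃ F : ℕ → ℕ, ∀ (n : ℕ) (a : Fin n → ℕ), Function.Injective a → (∀ i, 0 < a i) →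
      ToricBases.size (ToricBases.universalMarkovBasis K a) ≤
        F (ToricBases.size (ToricBases.universalGroebnerBasis K a))) ∧
    -- the universal Markov basis is not bounded in terms of the circuits
    (¬ ∃ F : ℕ → ℕ, ∀ (n : ℕ) (a : Fin n → ℕ), Function.Injective a → (∀ i, 0 < a i) →
      ToricBases.size (ToricBases.universalMarkovBasis K a) ≤
        F (ToricBases.size (ToricBases.circuits K a))) := by
  -- The choice T = 2ᴺ⁺¹ is prime to 5, at least 2 and larger than N.
  have hT : ∀ N : ℕ, ¬ 5 ∣ 2 ^ (N + 1) := fun N h =>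
    absurd (Nat.Prime.dvd_of_dvd_pow (by norm_num) h) (by norm_num)
  have hT2 : ∀ N : ℕ, 2 ≤ 2 ^ (N + 1) := fun N => by
    simpa using Nat.pow_le_pow_right (n := 2) (by norm_num) (Nat.le_add_left 1 N)
  have hN : ∀ N : ℕ, N < 2 ^ (N + 1) := fun N => (Nat.lt_succ_self N).trans Nat.lt_two_pow_self
  have hU : ∀ N, ToricBases.size (ToricBases.universalGroebnerBasis K
      (ToricBases.weights (2 ^ (N + 1)))) = 3 := fun N => by
    rw [ToricBases.size, ToricBases.upToSign_universalGroebnerBasis (hT N) (hT2 N),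
      ToricBases.ncard_upToSign_circuitReps (by positivity)]
  have hC : ∀ N, ToricBases.size (ToricBases.circuits K
      (ToricBases.weights (2 ^ (N + 1)))) = 3 := fun N => by
    rw [ToricBases.size, ToricBases.upToSign_circuits (hT N) (by positivity),
      ToricBases.ncard_upToSign_circuitReps (by positivity)]
  have hG : ∀ N, N < ToricBases.size (ToricBases.graverBasis K
      (ToricBases.weights (2 ^ (N + 1)))) := fun N => by
    rw [ToricBases.size, ToricBases.upToSign_graverBasis (hT N) (hT2 N)]
    exact (hN N).trans_le ToricBases.le_ncard_upToSign_primitives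
  have hM : ∀ N, N < ToricBases.size (ToricBases.universalMarkovBasis K
      (ToricBases.weights (2 ^ (N + 1)))) := fun N => by
    rw [ToricBases.size, ToricBases.upToSign_universalMarkovBasis (hT N) (hT2 N)]
    exact (hN N).trans_le ToricBases.le_ncard_upToSign_primitives
  have hinj := fun N => ToricBases.weights_injective (hT N)
  have hpos := fun N => ToricBases.weights_pos (T := 2 ^ (N + 1)) (by positivity)
  refine ⟨fun N => ⟨ToricBases.weights (2 ^ (N + 1)),
    ToricBases.isMinimalNumericalGenerators_weights (hT N), ?_, hU N, ?_,
    ToricBases.graverBasis_finite (hT N), (hG N).le⟩, ?_, ?_, ?_, ?_⟩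
  · rw [ToricBases.upToSign_universalGroebnerBasis (hT N) (hT2 N),
      ToricBases.upToSign_circuits (hT N) (by positivity)]
  · rw [ToricBases.upToSign_graverBasis (hT N) (hT2 N),
      ToricBases.upToSign_universalMarkovBasis (hT N) (hT2 N)]
  · rintro ⟨F, hF⟩
    -- The bound would always be F 3, so N = F 3 contradicts it; the first 3 is the number of
    -- generators.
    have h := hF 3 _ (hinj (F 3)) (hpos (F 3))
    rw [hU] at h
    exact absurd (hG (F 3)) h.not_gt
  · rintro ⟨F, hF⟩
    have h := hF 3 _ (hinj (F 3)) (hpos (F 3))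
    rw [hC] at h
    exact absurd (hG (F 3)) h.not_gt
  · rintro ⟨F, hF⟩
    have h := hF 3 _ (hinj (F 3)) (hpos (F 3))
    rw [hU] at h
    exact absurd (hM (F 3)) h.not_gt
  · rintro ⟨F, hF⟩
    have h := hF 3 _ (hinj (F 3)) (hpos (F 3))
    rw [hC] at h
    exact absurd (hM (F 3)) h.not_gt
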